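/- Let $3\le r\le 8$ and let $S_r$ be the del Pezzo surface obtained by blowing up $r$ points of $\mathbb{P}^2$ in general position, so that $\mathrm{Pic}\,S_r=\mathbb{Z}h\oplus\mathbb{Z}e_1\oplus\cdots\oplus\mathbb{Z}e_r$ with intersection form $h^2=1$, $h\cdot e_i=0$, $e_i\cdot e_j=-\delta_{ij}$ and canonical class $K=-3h+\sum_{i=1}^r e_i$. A line is a class $l\in\mathrm{Pic}\,S_r$ with $l^2=K\cdot l=-1$; a ruling is a class $f\in\mathrm{Pic}\,S_r$ with $f^2=0$ and $K\cdot f=-2$; a root is a class $d\in\mathrm{Pic}\,S_r$ with $d^2=-2$ and $K\cdot d=0$. Let $F_r$ be the set of rulings. The Weyl group $W(S_r)$ is the group of automorphisms of $\mathrm{Pic}\,S_r$ generated by the reflections $\sigma_d(D)=D+(D\cdot d)\,d$ in the roots $d$. The Gosset polytope $(r-4)_{21}$ is the convex hull, in $\mathrm{Pic}\,S_r\otimes\mathbb{Q}$, of the $W(S_r)$-orbit of $e_r$; it lies in the affine hyperplane $-K\cdot D=1$, on which $-(D-D')^2$ is a Euclidean (positive definite) squared distance. An $(r-1)$-crosspolytope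 with centre $c$ is the convex hull of points $c\pm v_1,\dots,c\pm v_{r-1}$, where the $v_i$ are pairwise orthogonal of equal positive length for this metric. Then: 1. For every ruling $f\in F_r$ there are lines $l_1,l_2$ with $l_1\cdot l_2=1$ and $f=l_1+l_2$ in $\mathrm{Pic}\,S_r$. 2. The set $F_r$ is in bijection with the set of those facets of $(r-4)_{21}$ that are $(r-1)$-crosspolytopes; more precisely, there is a bijection that sends each ruling $f$ to a crosspolytope facet with centre $\tfrac12 f$. 3. The set $F_r$ is non-empty, it is preserved by $W(S_r)$, and $W(S_r)$ acts transitively on it. -/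

import Mathlib

namespace DelPezzo

/-- The free module `R h ⊕ R e₁ ⊕ ⋯ ⊕ R e_r`: coordinate `0` is the coefficient of `h`, coordinate
`i ≠ 0` the coefficient of `e_i`. For `R = ℤ` this is `Pic S_r`, where `S_r` is the del Pezzo surface
obtained by blowing up `r` points of the plane in general position, `h` is the pull-back of the class
of a line and the `e_i` are the exceptional classes. For `R = ℚ` it is `Pic S_r ⊗ ℚ`. -/
abbrev PicWith (R : Type) (r : ℕ) : Type := Fin (r + 1) → R

/-- The Picard group of `S_r`. -/
abbrev Pic (r : ℕ) : Type := PicWith ℤ r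

/-- `Pic S_r ⊗ ℚ`. -/
abbrev PicQ (r : ℕ) : Type := PicWith ℚ r

/-- The intersection form: `h² = 1`, `h · e_i = 0`, `e_i · e_j = -δ_ij`. -/
def inter {R : Type} [CommRing R] {r : ℕ} (D E : PicWith R r) : R :=
  D 0 * E 0 - ∑ i : Fin r, D i.succ * E i.succ

/-- The canonical class `K = -3h + e₁ + ⋯ + e_r`. -/
def canonical (r : ℕ) : Pic r := Fin.cons (-3) (fun _ => 1)

/-- The natural map `Pic S_r → Pic S_r ⊗ ℚ`. -/
def toQ {r : ℕ} (D : Pic r) : PicQ r := fun i => (D i : ℚ)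

/-- Lines: classes with `l² = K · l = -1`. -/
def lines (r : ℕ) : Set (Pic r) :=
  {l | inter l l = -1 ∧ inter (canonical r) l = -1}

/-- Rulings: classes with `f² = 0` and `K · f = -2`. -/
def rulings (r : ℕ) : Set (Pic r) :=
  {f | inter f f = 0 ∧ inter (canonical r) f = -2}

/-- Roots: classes with `d² = -2` and `K · d = 0`. -/
def roots (r : ℕ) : Set (Pic r) :=
  {d | inter d d = -2 ∧ inter (canonical r) d = 0}

theorem inter_add_left {r : ℕ} (D E d : Pic r) : inter (D + E) d = inter D d + inter E d := by
  simp only [inter, Pi.add_apply, add_mul, Finset.sum_add_distrib]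
  ring

theorem inter_smul_left {r : ℕ} (c : ℤ) (D d : Pic r) : inter (c • D) d = c * inter D d := by
  simp only [inter, Pi.smul_apply, smul_eq_mul, mul_sub, Finset.mul_sum, mul_assoc]

/-- The reflection `σ_d : D ↦ D + (D · d) d` in a root `d`. -/
def reflection {r : ℕ} (d : roots r) : Pic r ≃ₗ[ℤ] Pic r :=
  LinearEquiv.ofInvolutive
    { toFun := fun D => D + inter D d.1 • d.1
      map_add' := fun D E => by rw [inter_add_left, add_smul]; abel
      map_smul' := fun c D => by rw [inter_smul_left, mul_smul, RingHom.id_apply, smul_add] }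
    (fun D => by
      change D + inter D d.1 • d.1 + inter (D + inter D d.1 • d.1) d.1 • d.1 = D
      rw [inter_add_left, inter_smul_left, d.2.1, add_assoc, ← add_smul]
      have h : inter D d.1 + (inter D d.1 + inter D d.1 * -2) = 0 := by ring
      rw [h, zero_smul, add_zero])

/-- The Weyl group `W(S_r)`, generated by the reflections in the roots, acting on `Pic S_r`. -/
def weylGroup (r : ℕ) : Subgroup (Pic r ≃ₗ[ℤ] Pic r) :=
  Subgroup.closure (Set.range (reflection (r := r)))

/-- The exceptional class `e_r` (for `1 ≤ r`). -/
def lastExceptional (r : ℕ) : Pic r := Pi.single (Fin.last r) 1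

/-- The Gosset polytope `(r-4)₂₁` in the hyperplane `-K · D = 1` of `Pic S_r ⊗ ℚ`, obtained by
Wythoff's construction from the Dynkin diagram of `W(S_r)`: the convex hull of the orbit of `e_r`. This
is a point on the mirrors of all the simple roots `h - e₁ - e₂ - e₃`, `e_i - e_{i+1}`, except for the
mirror of `e_{r-1} - e_r` (and that of `h - e₁ - e₂ - e₃` if `r = 3`). -/
def gossetPolytope (r : ℕ) : Set (PicQ r) :=
  convexHull ℚ {x | ∃ w ∈ weylGroup r, x = toQ (w (lastExceptional r))}

/-- `F` is a face of the convex set `P`: it is cut out by a supporting hyperplane. -/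
def IsFace {r : ℕ} (P F : Set (PicQ r)) : Prop :=
  ∃ (φ : PicQ r →ₗ[ℚ] ℚ) (b : ℚ), (∀ x ∈ P, φ x ≤ b) ∧ F = {x ∈ P | φ x = b}

/-- `F` is an `n`-crosspolytope with centre `c`: the convex hull of the `2n` points `c ± v_i`, where
the `v_i` are pairwise orthogonal of the same positive length, for the metric `-(x · y)`, which is
positive definite on the hyperplanes `K · D = const`. -/
def IsCrosspolytope {r : ℕ} (n : ℕ) (c : PicQ r) (F : Set (PicQ r)) : Prop :=
  ∃ (ρ : ℚ) (v : Fin n → PicQ r), 0 < ρ ∧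
    (∀ i j, -inter (v i) (v j) = if i = j then ρ else 0) ∧
    F = convexHull ℚ (Set.range (fun i => c + v i) ∪ Set.range (fun i => c - v i))

/-- The `(r-1)`-crosspolytopes among the faces of the `r`-dimensional polytope `(r-4)₂₁`; as they
have dimension `r - 1`, they are facets. -/
def crosspolytopeFacets (r : ℕ) : Set (Set (PicQ r)) :=
  {F | IsFace (gossetPolytope r) F ∧ ∃ c, IsCrosspolytope (r - 1) c F}

end DelPezzo

/-! Everything rests on `eq_zero_of_canonical_inter_eq_zero`: since `r ≤ 8`, the form is negative
definite on the orthogonal complement of `K`, so classes of equal degree whose difference has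
non-negative square coincide.

Transitivity is a descent on the degree `f · h`. By Noether's inequality
(`exists_lt_of_mem_rulings`), a ruling of degree at least two is lowered by the reflection in some
`h - e_i - e_j - e_k`; in degree one only the classes `h - e_j` remain. A statement about one ruling
may thus be checked on `h - e_i = e_j + (h - e_i - e_j)`, which gives part 1.

A ruling `f` is non-negative on the vertices of the polytope, so `f · x = 0` cuts out a face. Its
vertices are `r - 1` pairs of lines with sum `f`, hence a crosspolytope with centre `f/2`; the
centre recovers `f`.

Conversely, the vertices of a crosspolytope face with centre `c` are lines, opposite ones adding up
to `2c`. Non-opposite vertices meet in `c²`, an integer at least `0`. If `c² = 0`, then `2c` is a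
ruling. If `c² ≥ 1`, the Hodge index bound leaves only `r = 8`, `c = -K`, the centre of symmetry of
the whole polytope; the face would then contain every vertex, which is absurd. -/

namespace DelPezzo

/-! ### The intersection form -/

section Form

variable {R : Type} [CommRing R] {r : ℕ}

theorem inter_comm (D E : PicWith R r) : inter D E = inter E D := by
  simp only [inter, mul_comm]

theorem add_inter (D E F : PicWith R r) : inter (D + E) F = inter D F + inter E F := by
  simp only [inter, Pi.add_apply, add_mul, Finset.sum_add_distrib]
  ring

theorem smul_inter (c : R) (D E : PicWith R r) : inter (c • D) E = c * inter D E := by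
  simp only [inter, Pi.smul_apply, smul_eq_mul, mul_sub, Finset.mul_sum, mul_assoc]

theorem inter_add (D E F : PicWith R r) : inter D (E + F) = inter D E + inter D F := by
  rw [inter_comm, add_inter, inter_comm E, inter_comm F]

theorem inter_smul (c : R) (D E : PicWith R r) : inter D (c • E) = c * inter D E := by
  rw [inter_comm, smul_inter, inter_comm E]

theorem neg_inter (D E : PicWith R r) : inter (-D) E = -inter D E := by
  rw [← neg_one_smul R, smul_inter, neg_one_mul]

theorem inter_neg (D E : PicWith R r) : inter D (-E) = -inter D E := by
  rw [inter_comm, neg_inter, inter_comm E]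

theorem sub_inter (D E F : PicWith R r) : inter (D - E) F = inter D F - inter E F := by
  rw [sub_eq_add_neg, add_inter, neg_inter, ← sub_eq_add_neg]

theorem inter_sub (D E F : PicWith R r) : inter D (E - F) = inter D E - inter D F := by
  rw [inter_comm, sub_inter, inter_comm E, inter_comm F]

/-- Intersection with a fixed class, as a linear form. -/
def interLeft (D : PicWith R r) : PicWith R r →ₗ[R] R where
  toFun E := inter D E
  map_add' := inter_add D
  map_smul' c E := inter_smul c D E

@[simp] theorem interLeft_apply (D E : PicWith R r) : interLeft D E = inter D E := rfl

end Form

variable {r : ℕ}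

@[simp] theorem inter_toQ (D E : Pic r) : inter (toQ D) (toQ E) = ((inter D E : ℤ) : ℚ) := by
  simp [inter, toQ]

theorem toQ_add (D E : Pic r) : toQ (D + E) = toQ D + toQ E := by
  ext i; simp [toQ]

theorem toQ_sub (D E : Pic r) : toQ (D - E) = toQ D - toQ E := by
  ext i; simp [toQ]

theorem toQ_neg (D : Pic r) : toQ (-D) = -toQ D := by
  ext i; simp [toQ]

theorem toQ_injective : Function.Injective (toQ (r := r)) := fun D E h => by
  ext i
  have := congrFun h i
  simpa [toQ] using this

theorem inter_canonical (D : Pic r) :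
    inter (canonical r) D = -3 * D 0 - ∑ i : Fin r, D i.succ := by
  simp [inter, canonical]

theorem inter_toQ_canonical (D : PicQ r) :
    inter (toQ (canonical r)) D = -3 * D 0 - ∑ i : Fin r, D i.succ := by
  simp [inter, canonical, toQ]

theorem inter_self {R : Type} [CommRing R] (D : PicWith R r) :
    inter D D = D 0 ^ 2 - ∑ i : Fin r, D i.succ ^ 2 := by
  simp only [inter, pow_two]

theorem canonical_inter_canonical : inter (canonical r) (canonical r) = 9 - r := by
  simp [inter, canonical]

theorem sq_sum_le (hr : r ≤ 8) (x : Fin r → ℚ) : (∑ i, x i) ^ 2 ≤ 8 * ∑ i, x i ^ 2 := by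
  have h := sq_sum_le_card_mul_sum_sq (s := Finset.univ) (f := x)
  rw [Finset.card_univ, Fintype.card_fin] at h
  have h0 : 0 ≤ ∑ i, x i ^ 2 := Finset.sum_nonneg fun i _ => sq_nonneg _
  have : (r : ℚ) ≤ 8 := by exact_mod_cast hr
  nlinarith

/-- The orthogonal complement of the canonical class is negative definite. -/
theorem eq_zero_of_canonical_inter_eq_zero (hr : r ≤ 8) {D : PicQ r}
    (hK : inter (toQ (canonical r)) D = 0) (hD : 0 ≤ inter D D) : D = 0 := by
  rw [inter_toQ_canonical] at hK
  rw [inter_self] at hD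
  have h := sq_sum_le hr fun i => D i.succ
  have hs : ∑ i : Fin r, D i.succ = -3 * D 0 := by linarith
  rw [hs] at h
  -- Cauchy–Schwarz gives `9 D₀² ≤ 8 ∑ Dᵢ² ≤ 8 D₀²`.
  have h0 : D 0 = 0 := by
    have : D 0 ^ 2 ≤ 0 := by nlinarith
    exact pow_eq_zero_iff (two_ne_zero) |>.1 (le_antisymm this (sq_nonneg _))
  have h1 : ∑ i : Fin r, D i.succ ^ 2 = 0 := by
    refine le_antisymm ?_ (Finset.sum_nonneg fun i _ => sq_nonneg _)
    rw [h0] at hD; linarith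
  rw [Finset.sum_eq_zero_iff_of_nonneg fun i _ => sq_nonneg _] at h1
  ext i
  refine Fin.cases h0 (fun j => ?_) i
  simpa using h1 j (Finset.mem_univ j)

theorem eq_of_inter_sub_nonneg (hr : r ≤ 8) {D E : Pic r}
    (hK : inter (canonical r) D = inter (canonical r) E)
    (h : 0 ≤ inter (D - E) (D - E)) : D = E := by
  apply toQ_injective
  rw [← sub_eq_zero, ← toQ_sub]
  apply eq_zero_of_canonical_inter_eq_zero hr
  · rw [inter_toQ, inter_sub, hK, sub_self, Int.cast_zero]
  · rw [inter_toQ]; exact_mod_cast h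

/-- `(l - m)² = -2 - 2 l · m`, which is non-negative here. -/
theorem eq_of_lines_of_inter_le (hr : r ≤ 8) {l m : Pic r} (hl : l ∈ lines r) (hm : m ∈ lines r)
    (h : inter l m ≤ -1) : l = m := by
  apply eq_of_inter_sub_nonneg hr (hl.2.trans hm.2.symm)
  rw [sub_inter, inter_sub, inter_sub, inter_comm m l, hl.1, hm.1]
  linarith

/-! ### The Weyl group -/

theorem reflection_apply (d : roots r) (D : Pic r) :
    reflection d D = D + inter D d.1 • d.1 := rfl

theorem reflection_mem (d : roots r) : reflection d ∈ weylGroup r :=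
  Subgroup.subset_closure ⟨d, rfl⟩

theorem inter_weyl {w : Pic r ≃ₗ[ℤ] Pic r} (hw : w ∈ weylGroup r) (D E : Pic r) :
    inter (w D) (w E) = inter D E := by
  induction hw using Subgroup.closure_induction generalizing D E with
  | mem w h =>
    obtain ⟨d, rfl⟩ := h
    simp only [reflection_apply, add_inter, inter_add, smul_inter, inter_smul, d.2.1,
      inter_comm d.1 E]
    ring
  | one => rfl
  | mul v w _ _ hv hw => exact (hv _ _).trans (hw _ _)
  | inv w _ hw =>
    rw [← hw]
    change inter (w (w.symm D)) (w (w.symm E)) = _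
    simp

theorem weyl_canonical {w : Pic r ≃ₗ[ℤ] Pic r} (hw : w ∈ weylGroup r) :
    w (canonical r) = canonical r := by
  induction hw using Subgroup.closure_induction with
  | mem w h =>
    obtain ⟨d, rfl⟩ := h
    rw [reflection_apply, d.2.2, zero_smul, add_zero]
  | one => rfl
  | mul v w _ _ hv hw => exact (congrArg v hw).trans hv
  | inv w _ hw =>
    change w.symm _ = _
    rw [LinearEquiv.symm_apply_eq, hw]

theorem canonical_inter_weyl {w : Pic r ≃ₗ[ℤ] Pic r} (hw : w ∈ weylGroup r) (D : Pic r) :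
    inter (canonical r) (w D) = inter (canonical r) D := by
  conv_lhs => rw [← weyl_canonical hw, inter_weyl hw]

theorem weyl_mem_lines {w : Pic r ≃ₗ[ℤ] Pic r} (hw : w ∈ weylGroup r) {l : Pic r}
    (hl : l ∈ lines r) : w l ∈ lines r :=
  ⟨(inter_weyl hw l l).trans hl.1, (canonical_inter_weyl hw l).trans hl.2⟩

theorem weyl_mem_rulings {w : Pic r ≃ₗ[ℤ] Pic r} (hw : w ∈ weylGroup r) {f : Pic r}
    (hf : f ∈ rulings r) : w f ∈ rulings r :=
  ⟨(inter_weyl hw f f).trans hf.1, (canonical_inter_weyl hw f).trans hf.2⟩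

theorem symm_mem_weylGroup {w : Pic r ≃ₗ[ℤ] Pic r} (hw : w ∈ weylGroup r) :
    w.symm ∈ weylGroup r :=
  (weylGroup r).inv_mem hw

/-- Two skew lines are exchanged by a reflection. -/
theorem exists_weyl_of_inter_eq_zero {l m : Pic r} (hl : l ∈ lines r) (hm : m ∈ lines r)
    (h : inter l m = 0) : ∃ w ∈ weylGroup r, w l = m := by
  have hd : m - l ∈ roots r := by
    constructor
    · simp only [sub_inter, inter_sub, hl.1, hm.1, h, inter_comm m l]; norm_num
    · rw [inter_sub, hl.2, hm.2]; norm_num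
  refine ⟨_, reflection_mem ⟨m - l, hd⟩, ?_⟩
  rw [reflection_apply]
  simp only [inter_sub, hl.1, h]
  simp

/-! ### The standard basis -/

/-- The class `h` of the pull-back of a line of the plane. -/
def hyperplane (r : ℕ) : Pic r := Pi.single 0 1

/-- The exceptional class `e_i`. -/
def exceptional (i : Fin r) : Pic r := Pi.single i.succ 1

@[simp] theorem hyperplane_zero : hyperplane r 0 = 1 := by simp [hyperplane]

@[simp] theorem hyperplane_succ (i : Fin r) : hyperplane r i.succ = 0 := by
  simp [hyperplane]

@[simp] theorem exceptional_zero (i : Fin r) : exceptional i 0 = 0 := by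
  simp [exceptional]

theorem exceptional_succ (i j : Fin r) : exceptional i j.succ = if j = i then 1 else 0 := by
  simp [exceptional, Pi.single_apply]

@[simp] theorem inter_hyperplane (D : Pic r) : inter D (hyperplane r) = D 0 := by
  simp [inter]

@[simp] theorem inter_exceptional (D : Pic r) (i : Fin r) :
    inter D (exceptional i) = -D i.succ := by
  simp [inter, exceptional_succ]

@[simp] theorem canonical_zero : canonical r 0 = -3 := rfl

@[simp] theorem canonical_succ (i : Fin r) : canonical r i.succ = 1 := rfl

theorem exceptional_mem_lines (i : Fin r) : exceptional i ∈ lines r := by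
  constructor <;> simp [exceptional_succ]

theorem hyperplane_sub_mem_lines {i j : Fin r} (h : i ≠ j) :
    hyperplane r - exceptional i - exceptional j ∈ lines r := by
  constructor <;> simp [inter_sub, exceptional_succ, h, h.symm]

theorem hyperplane_sub_mem_rulings (i : Fin r) : hyperplane r - exceptional i ∈ rulings r := by
  constructor <;> simp [inter_sub, exceptional_succ]

theorem hyperplane_sub_mem_roots {i j k : Fin r} (hij : i ≠ j) (hik : i ≠ k) (hjk : j ≠ k) :
    hyperplane r - exceptional i - exceptional j - exceptional k ∈ roots r := by
  constructor <;>
    simp [inter_sub, exceptional_succ, hij, hik, hjk, hij.symm, hik.symm, hjk.symm]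

theorem exceptional_sub_mem_roots {i j : Fin r} (hij : i ≠ j) :
    exceptional i - exceptional j ∈ roots r := by
  constructor <;> simp [inter_sub, exceptional_succ, hij, hij.symm]

theorem exists_lastExceptional_eq (hr : 3 ≤ r) : ∃ i : Fin r, lastExceptional r = exceptional i := by
  obtain ⟨n, rfl⟩ : ∃ n, r = n + 1 := ⟨r - 1, by omega⟩
  exact ⟨Fin.last n, by rw [lastExceptional, exceptional, Fin.succ_last]⟩

/-! ### The vertices -/

/-- The Weyl orbit of `e_r`. -/
def lineOrbit (r : ℕ) : Set (Pic r) := {l | ∃ w ∈ weylGroup r, w (lastExceptional r) = l}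

theorem gossetPolytope_eq : gossetPolytope r = convexHull ℚ (toQ '' lineOrbit r) := by
  rw [gossetPolytope]
  congr 1
  ext x
  constructor
  · rintro ⟨w, hw, rfl⟩
    exact ⟨_, ⟨w, hw, rfl⟩, rfl⟩
  · rintro ⟨_, ⟨w, hw, rfl⟩, rfl⟩
    exact ⟨w, hw, rfl⟩

theorem weyl_mem_lineOrbit {w : Pic r ≃ₗ[ℤ] Pic r} (hw : w ∈ weylGroup r) {l : Pic r}
    (hl : l ∈ lineOrbit r) : w l ∈ lineOrbit r := by
  obtain ⟨v, hv, rfl⟩ := hl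
  exact ⟨w * v, (weylGroup r).mul_mem hw hv, rfl⟩

theorem lineOrbit_subset_lines (hr : 3 ≤ r) : lineOrbit r ⊆ lines r := by
  rintro _ ⟨w, hw, rfl⟩
  obtain ⟨i, hi⟩ := exists_lastExceptional_eq hr
  rw [hi]
  exact weyl_mem_lines hw (exceptional_mem_lines i)

/-- Orbit membership is propagated along chains of skew lines; transitivity of the Weyl group on all
lines is never needed. -/
theorem mem_lineOrbit_of_inter_eq_zero (hr : 3 ≤ r) {l m : Pic r} (hl : l ∈ lineOrbit r)
    (hm : m ∈ lines r) (h : inter l m = 0) : m ∈ lineOrbit r := by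
  obtain ⟨w, hw, rfl⟩ := exists_weyl_of_inter_eq_zero (lineOrbit_subset_lines hr hl) hm h
  exact weyl_mem_lineOrbit hw hl

theorem exceptional_mem_lineOrbit (hr : 3 ≤ r) (i : Fin r) : exceptional i ∈ lineOrbit r := by
  obtain ⟨j, hj⟩ := exists_lastExceptional_eq hr
  have h : exceptional j ∈ lineOrbit r := hj ▸ ⟨1, (weylGroup r).one_mem, rfl⟩
  by_cases hij : i = j
  · rwa [hij]
  · exact mem_lineOrbit_of_inter_eq_zero hr h (exceptional_mem_lines i)
      (by simp [exceptional_succ, hij])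

theorem hyperplane_sub_mem_lineOrbit (hr : 3 ≤ r) {i j : Fin r} (h : i ≠ j) :
    hyperplane r - exceptional i - exceptional j ∈ lineOrbit r := by
  obtain ⟨k, hk⟩ : ∃ k : Fin r, k ∉ ({i, j} : Finset (Fin r)) := by
    by_contra! hall
    have h1 := Finset.card_le_card (fun k _ => hall k : (Finset.univ : Finset (Fin r)) ⊆ {i, j})
    have h2 := Finset.card_le_two (a := i) (b := j)
    rw [Finset.card_univ, Fintype.card_fin] at h1
    omega
  simp only [Finset.mem_insert, Finset.mem_singleton, not_or] at hk
  exact mem_lineOrbit_of_inter_eq_zero hr (exceptional_mem_lineOrbit hr k)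
    (hyperplane_sub_mem_lines h)
    (by simp [inter_sub, exceptional_succ, Ne.symm hk.1, Ne.symm hk.2])

/-! ### Transitivity on rulings -/

theorem exists_sq_eq_one_of_sum_sq_eq_one {ι : Type*} [DecidableEq ι] {s : Finset ι} {x : ι → ℤ}
    (h : ∑ i ∈ s, x i ^ 2 = 1) : ∃ j ∈ s, x j ^ 2 = 1 ∧ ∀ k ∈ s, k ≠ j → x k = 0 := by
  obtain ⟨j, hj, hj0⟩ : ∃ j ∈ s, x j ≠ 0 := by
    by_contra! hall
    rw [Finset.sum_eq_zero fun i hi => by rw [hall i hi]; rfl] at h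
    exact zero_ne_one h
  rw [← Finset.add_sum_erase s _ hj] at h
  have h1 : 0 < x j ^ 2 := by positivity
  have h2 : 0 ≤ ∑ i ∈ s.erase j, x i ^ 2 := Finset.sum_nonneg fun i _ => sq_nonneg _
  have h3 : ∑ i ∈ s.erase j, x i ^ 2 = 0 := by omega
  rw [Finset.sum_eq_zero_iff_of_nonneg fun i _ => sq_nonneg _] at h3
  refine ⟨j, hj, by omega, fun k hk hkj => ?_⟩
  simpa using h3 k (Finset.mem_erase.2 ⟨hkj, hk⟩)

theorem sum_sq_of_mem_rulings {f : Pic r} (hf : f ∈ rulings r) :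
    ∑ i : Fin r, f i.succ ^ 2 = f 0 ^ 2 := by
  have := hf.1
  rw [inter_self] at this
  linarith

theorem sum_of_mem_rulings {f : Pic r} (hf : f ∈ rulings r) :
    ∑ i : Fin r, f i.succ = 2 - 3 * f 0 := by
  have := hf.2
  rw [inter_canonical] at this
  linarith

/-- With `a = f 0`, Cauchy–Schwarz reads `(2 - 3a)² ≤ 8a²`, that is `a² - 12a + 4 ≤ 0`, which fails
for `a ≤ 0`. -/
theorem one_le_of_mem_rulings (hr : r ≤ 8) {f : Pic r} (hf : f ∈ rulings r) : 1 ≤ f 0 := by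
  have h := sq_sum_le_card_mul_sum_sq (s := Finset.univ) (f := fun i : Fin r => f i.succ)
  rw [Finset.card_univ, Fintype.card_fin, sum_sq_of_mem_rulings hf, sum_of_mem_rulings hf] at h
  have : (r : ℤ) ≤ 8 := by exact_mod_cast hr
  nlinarith [sq_nonneg (f 0)]

/-- Cauchy–Schwarz on the other coefficients, at most seven of them, excludes a coefficient `t ≥ 1`.
Geometrically, `f · e_i ≥ 0`. -/
theorem nonpos_of_mem_rulings (hr : r ≤ 8) {f : Pic r} (hf : f ∈ rulings r) (i : Fin r) :
    f i.succ ≤ 0 := by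
  have h := sq_sum_le_card_mul_sum_sq (s := Finset.univ.erase i)
    (f := fun i : Fin r => f i.succ)
  have h1 := sum_sq_of_mem_rulings hf
  have h2 := sum_of_mem_rulings hf
  rw [← Finset.add_sum_erase _ _ (Finset.mem_univ i)] at h1 h2
  have h3 : 0 ≤ ∑ j ∈ Finset.univ.erase i, f j.succ ^ 2 :=
    Finset.sum_nonneg fun i _ => sq_nonneg _
  have hc : ((Finset.univ.erase i).card : ℤ) ≤ 7 := by
    rw [Finset.card_erase_of_mem (Finset.mem_univ i), Finset.card_univ, Fintype.card_fin]
    omega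
  have ha := one_le_of_mem_rulings hr hf
  rw [eq_sub_of_add_eq' h2, eq_sub_of_add_eq' h1] at h
  rw [eq_sub_of_add_eq' h1] at h3
  generalize f i.succ = t at *
  generalize f 0 = a at *
  by_contra! ht
  have h4 : (2 - 3 * a - t) ^ 2 ≤ 7 * (a ^ 2 - t ^ 2) := h.trans (by nlinarith)
  nlinarith [mul_nonneg (sub_nonneg.2 ha) (sub_nonneg.2 (Int.add_one_le_iff.2 ht)),
    sq_nonneg (2 * a - 3), sq_nonneg (t - 1)]

/-- Noether's inequality for rulings: the degree of a ruling of degree at least two is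
lowered by a quadratic transformation. -/
theorem exists_lt_of_mem_rulings (hr₃ : 3 ≤ r) (hr₈ : r ≤ 8) {f : Pic r} (hf : f ∈ rulings r)
    (h : 2 ≤ f 0) : ∃ i j k : Fin r, i ≠ j ∧ i ≠ k ∧ j ≠ k ∧
      f 0 + f i.succ + f j.succ + f k.succ < 0 := by
  have hcard : (Finset.univ : Finset (Fin r)).card = r := by simp
  obtain ⟨i, hi, hmi⟩ := Finset.exists_min_image Finset.univ (fun i : Fin r => f i.succ)
    (Finset.card_pos.1 (by omega))
  have hci := Finset.card_erase_of_mem hi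
  obtain ⟨j, hj, hmj⟩ := Finset.exists_min_image (Finset.univ.erase i)
    (fun i : Fin r => f i.succ) (Finset.card_pos.1 (by omega))
  have hcj := Finset.card_erase_of_mem hj
  obtain ⟨k, hk, hmk⟩ := Finset.exists_min_image ((Finset.univ.erase i).erase j)
    (fun i : Fin r => f i.succ) (Finset.card_pos.1 (by omega))
  have hij : f i.succ ≤ f j.succ := hmi j (Finset.mem_univ _)
  have hjk : f j.succ ≤ f k.succ := hmj k (Finset.mem_of_mem_erase hk)
  refine ⟨i, j, k, (Finset.ne_of_mem_erase hj).symm,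
    (Finset.ne_of_mem_erase (Finset.mem_of_mem_erase hk)).symm,
    (Finset.ne_of_mem_erase hk).symm, ?_⟩
  by_contra! hle
  have h1 := sum_sq_of_mem_rulings hf
  have h2 := sum_of_mem_rulings hf
  rw [← Finset.add_sum_erase _ _ hi, ← Finset.add_sum_erase _ _ hj] at h1 h2
  -- Each remaining coefficient lies between `f k.succ` and `0`.
  have h3 : ∑ m ∈ (Finset.univ.erase i).erase j, f m.succ ^ 2 ≤
      f k.succ * ∑ m ∈ (Finset.univ.erase i).erase j, f m.succ := by
    rw [Finset.mul_sum]
    refine Finset.sum_le_sum fun m hm => ?_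
    have := hmk m hm
    have := nonpos_of_mem_rulings hr₈ hf m
    nlinarith
  have h4 : f i.succ + f j.succ + ∑ m ∈ (Finset.univ.erase i).erase j, f m.succ = 2 - 3 * f 0 := by
    linarith
  have hk0 := nonpos_of_mem_rulings hr₈ hf k
  have hsq : f i.succ ^ 2 ≤ f 0 ^ 2 := by
    rw [← h1]
    have : 0 ≤ ∑ m ∈ (Finset.univ.erase i).erase j, f m.succ ^ 2 :=
      Finset.sum_nonneg fun i _ => sq_nonneg _
    have := sq_nonneg (f j.succ)
    linarith
  have hia : -f i.succ ≤ f 0 := by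
    apply le_of_sq_le_sq _ (by linarith)
    linarith [neg_sq (f i.succ)]
  have hz : f k.succ = 0 → 0 ≤ ∑ m ∈ (Finset.univ.erase i).erase j, f m.succ :=
    fun hz => Finset.sum_nonneg fun m hm => hz.symm.trans_le (hmk m hm)
  rw [eq_sub_of_add_eq' h4] at h3 hz
  have h5 : f 0 ^ 2 ≤ f i.succ ^ 2 + f j.succ ^ 2 +
      f k.succ * (2 - 3 * f 0 - (f i.succ + f j.succ)) := by linarith
  generalize f i.succ = x at *
  generalize f j.succ = y at *
  generalize f k.succ = z at *
  generalize f 0 = a at *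
  -- Inserting `h6`, `h7`, `h8` into `h5` gives `a² ≤ a² + 2z`, so `z = 0`. Then `x + y ≤ 2 - 3a`
  -- and `x + y ≥ -a` contradict `a ≥ 2`.
  have h6 : y * (y - z) ≤ x * (y - z) :=
    mul_le_mul_of_nonpos_right hij (sub_nonpos.2 hjk)
  have h7 : (-x) * (2 * z - x - y) ≤ (-x) * (a + 3 * z) :=
    mul_le_mul_of_nonneg_left (by linarith) (by linarith)
  have h8 : (-x) * (a + 3 * z) ≤ a * (a + 3 * z) :=
    mul_le_mul_of_nonneg_right hia (by linarith)
  have h9 : z = 0 := by linarith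
  have := hz h9
  linarith

/-- Every ruling is equivalent to `h - e_i` under the Weyl group. -/
theorem exists_weyl_eq_hyperplane_sub (hr₃ : 3 ≤ r) (hr₈ : r ≤ 8) (i : Fin r) {f : Pic r}
    (hf : f ∈ rulings r) : ∃ w ∈ weylGroup r, w f = hyperplane r - exceptional i := by
  induction hn : (f 0).toNat using Nat.strong_induction_on generalizing f with
  | _ n ih =>
    have h1 := one_le_of_mem_rulings hr₈ hf
    rcases h1.eq_or_lt with h1 | h1
    · have hs := sum_sq_of_mem_rulings hf
      have hs' := sum_of_mem_rulings hf
      rw [← h1] at hs hs'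
      obtain ⟨j, -, hj, hk⟩ := exists_sq_eq_one_of_sum_sq_eq_one hs
      rw [Finset.sum_eq_single j (fun k hk' hkj => hk k hk' hkj) (by simp)] at hs'
      have hfj : f = hyperplane r - exceptional j := by
        ext m
        refine Fin.cases (by simp [← h1]) (fun m => ?_) m
        by_cases hm : m = j
        · subst hm; simp [exceptional_succ, hs']
        · simp [exceptional_succ, hm, hk m (Finset.mem_univ m) hm]
      by_cases hij : i = j
      · exact ⟨1, (weylGroup r).one_mem, by rw [hij, hfj]; rfl⟩
      · refine ⟨_, reflection_mem ⟨_, exceptional_sub_mem_roots hij⟩, ?_⟩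
        rw [reflection_apply, hfj]
        simp [inter_sub, exceptional_succ, hij]
    · obtain ⟨j, k, m, hjk, hjm, hkm, hlt⟩ := exists_lt_of_mem_rulings hr₃ hr₈ hf h1
      have hw := reflection_mem ⟨_, hyperplane_sub_mem_roots hjk hjm hkm⟩
      have hf' := weyl_mem_rulings hw hf
      have h0 : reflection ⟨_, hyperplane_sub_mem_roots hjk hjm hkm⟩ f 0 =
          f 0 + (f 0 + f j.succ + f k.succ + f m.succ) := by
        rw [reflection_apply]
        simp [inter_sub]
      have h1' := one_le_of_mem_rulings hr₈ hf'
      obtain ⟨v, hv, hvf⟩ := ih _ (by omega) hf' rfl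
      exact ⟨_, (weylGroup r).mul_mem hv hw, hvf⟩

theorem exists_weyl_hyperplane_sub_eq (hr₃ : 3 ≤ r) (hr₈ : r ≤ 8) (i : Fin r) {f : Pic r}
    (hf : f ∈ rulings r) : ∃ w ∈ weylGroup r, w (hyperplane r - exceptional i) = f := by
  obtain ⟨w, hw, h⟩ := exists_weyl_eq_hyperplane_sub hr₃ hr₈ i hf
  exact ⟨w.symm, symm_mem_weylGroup hw, by rw [← h, LinearEquiv.symm_apply_apply]⟩

theorem exists_weyl_eq_of_mem_rulings (hr₃ : 3 ≤ r) (hr₈ : r ≤ 8) {f g : Pic r}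
    (hf : f ∈ rulings r) (hg : g ∈ rulings r) : ∃ w ∈ weylGroup r, w f = g := by
  obtain ⟨v, hv, hvf⟩ := exists_weyl_eq_hyperplane_sub hr₃ hr₈ ⟨0, by omega⟩ hf
  obtain ⟨w, hw, hwg⟩ := exists_weyl_hyperplane_sub_eq hr₃ hr₈ ⟨0, by omega⟩ hg
  exact ⟨w * v, (weylGroup r).mul_mem hw hv, by rw [← hwg, ← hvf]; rfl⟩

theorem exists_lines_add_eq (hr₃ : 3 ≤ r) (hr₈ : r ≤ 8) {f : Pic r} (hf : f ∈ rulings r) :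
    ∃ l₁ ∈ lines r, ∃ l₂ ∈ lines r, inter l₁ l₂ = 1 ∧ f = l₁ + l₂ := by
  obtain ⟨i, j, hij⟩ : ∃ i j : Fin r, i ≠ j := ⟨⟨0, by omega⟩, ⟨1, by omega⟩, by simp⟩
  obtain ⟨w, hw, hwf⟩ := exists_weyl_hyperplane_sub_eq hr₃ hr₈ i hf
  refine ⟨_, weyl_mem_lines hw (exceptional_mem_lines j), _,
    weyl_mem_lines hw (hyperplane_sub_mem_lines hij), ?_, ?_⟩
  · rw [inter_weyl hw]
    simp [inter_sub, exceptional_succ, hij]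
  · rw [← map_add, ← hwf]
    congr 1
    abel

/-! ### Lines in a fibre of a ruling -/

/-- Once `l` is moved to an exceptional class, this is the sign of a coefficient of a ruling. -/
theorem line_inter_ruling_nonneg (hr₃ : 3 ≤ r) (hr₈ : r ≤ 8) {l f : Pic r} (hl : l ∈ lineOrbit r)
    (hf : f ∈ rulings r) : 0 ≤ inter l f := by
  obtain ⟨w, hw, rfl⟩ := hl
  obtain ⟨i, hi⟩ := exists_lastExceptional_eq hr₃
  have hf' := nonpos_of_mem_rulings hr₈ (weyl_mem_rulings (symm_mem_weylGroup hw) hf) i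
  rw [← w.apply_symm_apply f, inter_weyl hw, hi, inter_comm, inter_exceptional]
  exact neg_nonneg.2 hf'

/-- Orthogonality makes the coefficients of `h` and `e_i` cancel in `l²`, so the squares of the
others add up to one; the degree then fixes `l`. -/
theorem eq_or_eq_of_inter_hyperplane_sub {i : Fin r} {l : Pic r} (hl : l ∈ lines r)
    (h : inter l (hyperplane r - exceptional i) = 0) :
    ∃ j ≠ i, l = exceptional j ∨ l = hyperplane r - exceptional i - exceptional j := by
  have h1 := hl.1
  have h2 := hl.2
  rw [inter_self, ← Finset.add_sum_erase _ _ (Finset.mem_univ i)] at h1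
  rw [inter_canonical, ← Finset.add_sum_erase _ _ (Finset.mem_univ i)] at h2
  rw [inter_sub, inter_hyperplane, inter_exceptional] at h
  have hi : l i.succ = -l 0 := by linarith
  rw [hi] at h1 h2
  obtain ⟨j, hj, hj1, hk⟩ := exists_sq_eq_one_of_sum_sq_eq_one
    (show ∑ k ∈ Finset.univ.erase i, l k.succ ^ 2 = 1 by linarith [neg_sq (l 0)])
  rw [Finset.sum_eq_single_of_mem j hj hk] at h2
  have hji := Finset.ne_of_mem_erase hj
  refine ⟨j, hji, (sq_eq_sq_iff_eq_or_eq_neg.1 (hj1.trans (one_pow 2).symm)).imp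
    (fun h1 => ?_) fun h1 => ?_⟩
  all_goals
    have h0 : l 0 = (1 - l j.succ) / 2 := by omega
    rw [h1] at h0
    norm_num at h0
    ext m
    refine Fin.cases (by simp [h0]) (fun m => ?_) m
    by_cases hm : m = j
    · subst hm; simp [exceptional_succ, h1, hji]
    by_cases hm' : m = i
    · subst hm'; simp [exceptional_succ, hi, h0, hm]
    · simp [exceptional_succ, hm, hm', hk m (Finset.mem_erase.2 ⟨hm', Finset.mem_univ m⟩) hm]

theorem hyperplane_sub_inter_cases (hr₃ : 3 ≤ r) {w : Pic r ≃ₗ[ℤ] Pic r} (hw : w ∈ weylGroup r)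
    {i : Fin r} {l : Pic r} (hl : l ∈ lineOrbit r)
    (h : inter l (w (hyperplane r - exceptional i)) = 0) :
    ∃ j ≠ i, l = w (exceptional j) ∨
      l = w (hyperplane r - exceptional i) - w (exceptional j) := by
  have hl' := weyl_mem_lines (symm_mem_weylGroup hw) (lineOrbit_subset_lines hr₃ hl)
  rw [← w.apply_symm_apply l, inter_weyl hw] at h
  obtain ⟨j, hj, h⟩ := eq_or_eq_of_inter_hyperplane_sub hl' h
  refine ⟨j, hj, ?_⟩
  simpa only [LinearEquiv.symm_apply_eq, map_sub] using h

/-- `f - l` is the other component of the reducible fibre containing `l`, and the vertex opposite to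
`l` in the facet of `f`. -/
theorem sub_mem_lineOrbit (hr₃ : 3 ≤ r) (hr₈ : r ≤ 8) {l f : Pic r} (hl : l ∈ lineOrbit r)
    (hf : f ∈ rulings r) (h : inter l f = 0) : f - l ∈ lineOrbit r := by
  have i : Fin r := ⟨0, by omega⟩
  obtain ⟨w, hw, rfl⟩ := exists_weyl_hyperplane_sub_eq hr₃ hr₈ i hf
  obtain ⟨j, hj, rfl | rfl⟩ := hyperplane_sub_inter_cases hr₃ hw hl h
  · rw [← map_sub]
    exact weyl_mem_lineOrbit hw (hyperplane_sub_mem_lineOrbit hr₃ hj.symm)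
  · rw [sub_sub_cancel]
    exact weyl_mem_lineOrbit hw (exceptional_mem_lineOrbit hr₃ j)

/-! ### Exposed faces of convex hulls -/

section Convex

variable {E : Type*} [AddCommGroup E] [Module ℚ E]

theorem le_of_mem_convexHull {S : Set E} {φ : E →ₗ[ℚ] ℚ} {b : ℚ} (h : ∀ x ∈ S, φ x ≤ b) {x : E}
    (hx : x ∈ convexHull ℚ S) : φ x ≤ b :=
  convexHull_min h (convex_halfSpace_le φ.isLinear b) hx

theorem mem_convexHull_of_eq {S : Set E} {φ : E →ₗ[ℚ] ℚ} {b : ℚ} (h : ∀ x ∈ S, φ x ≤ b) {x : E}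
    (hx : x ∈ convexHull ℚ S) (hb : φ x = b) : x ∈ convexHull ℚ {x ∈ S | φ x = b} := by
  -- The conclusion is built into a convex set containing `S`, so that minimality of the hull
  -- applies. Equality at a proper convex combination forces it at both ends.
  have hc : Convex ℚ {x | φ x ≤ b ∧ (φ x = b → x ∈ convexHull ℚ {x ∈ S | φ x = b})} := by
    rw [convex_iff_forall_pos]
    rintro x ⟨hx, hx'⟩ y ⟨hy, hy'⟩ s t hs ht hst
    simp only [Set.mem_ofPred_eq, map_add, map_smul, smul_eq_mul]
    have h1 : s * φ x ≤ s * b := mul_le_mul_of_nonneg_left hx hs.le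
    have h2 : t * φ y ≤ t * b := mul_le_mul_of_nonneg_left hy ht.le
    have h3 : s * b + t * b = b := by rw [← add_mul, hst, one_mul]
    refine ⟨by linarith, fun h => ?_⟩
    have hxb : φ x = b := mul_left_cancel₀ hs.ne' (by linarith)
    have hyb : φ y = b := mul_left_cancel₀ ht.ne' (by linarith)
    exact convex_convexHull ℚ _ (hx' hxb) (hy' hyb) hs.le ht.le hst
  have hS : S ⊆ {x | φ x ≤ b ∧ (φ x = b → x ∈ convexHull ℚ {x ∈ S | φ x = b})} :=
    fun y hy => ⟨h y hy, fun hyb => subset_convexHull ℚ _ ⟨hy, hyb⟩⟩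
  exact (convexHull_min hS hc hx).2 hb

theorem exists_mem_of_mem_convexHull {S : Set E} {φ : E →ₗ[ℚ] ℚ} {b : ℚ} (h : ∀ x ∈ S, φ x ≤ b)
    {x : E} (hx : x ∈ convexHull ℚ S) (hb : φ x = b) : ∃ y ∈ S, φ y = b :=
  convexHull_nonempty_iff.1 ⟨x, mem_convexHull_of_eq h hx hb⟩

/-- A strictly exposed point of an exposed face of the convex hull of `S` lies in `S`. -/
theorem mem_of_exposed {S V : Set E} {φ ψ : E →ₗ[ℚ] ℚ} {b : ℚ}
    (hφ : ∀ x ∈ convexHull ℚ S, φ x ≤ b) (hV : {x ∈ convexHull ℚ S | φ x = b} = convexHull ℚ V)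
    {p : E} (hp : p ∈ V) (hψ : ∀ x ∈ V, x ≠ p → ψ x < ψ p) : p ∈ S := by
  have hS : ∀ x ∈ S, φ x ≤ b := fun x hx => hφ x (subset_convexHull ℚ S hx)
  have hψ' : ∀ x ∈ V, ψ x ≤ ψ p := fun x hx => by
    by_cases h : x = p
    · rw [h]
    · exact (hψ x hx h).le
  have hpF := subset_convexHull ℚ V hp
  rw [← hV] at hpF
  have hA : ∀ x ∈ {x ∈ S | φ x = b}, x ∈ convexHull ℚ V := fun x hx =>
    hV ▸ ⟨subset_convexHull ℚ S hx.1, hx.2⟩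
  -- `p` lies in the hull of the points of `S` on the face, so `ψ` attains its maximum `ψ p` at one
  -- of these, `a`. As `a` also lies in the hull of `V`, strictness gives `a = p`.
  obtain ⟨a, ha, hap⟩ := exists_mem_of_mem_convexHull (φ := ψ) (b := ψ p)
    (fun x hx => le_of_mem_convexHull hψ' (hA x hx)) (mem_convexHull_of_eq hS hpF.1 hpF.2) rfl
  have hav := mem_convexHull_of_eq hψ' (hA a ha) hap
  have hsub : {x ∈ V | ψ x = ψ p} ⊆ {p} := fun x hx => by
    by_contra h
    exact (hψ x hx.1 h).ne hx.2
  have := convexHull_mono hsub hav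
  rw [convexHull_singleton, Set.mem_singleton_iff] at this
  exact this ▸ ha.1

end Convex

theorem mem_gossetPolytope {l : Pic r} (hl : l ∈ lineOrbit r) : toQ l ∈ gossetPolytope r := by
  rw [gossetPolytope_eq]
  exact subset_convexHull ℚ _ ⟨l, hl, rfl⟩

/-- Every line is an extreme point of the convex hull of any set of lines containing it. -/
theorem mem_of_mem_convexHull_lines (hr : r ≤ 8) {l : Pic r} (hl : l ∈ lines r) {S : Set (PicQ r)}
    (hS : S ⊆ toQ '' lines r) (h : toQ l ∈ convexHull ℚ S) : toQ l ∈ S := by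
  have hle : ∀ m ∈ lines r, -1 ≤ inter l m := fun m hm => by
    by_contra! hlt
    have := eq_of_lines_of_inter_le hr hl hm hlt.le
    subst this
    exact hlt.ne hl.1
  -- Among lines, `-(l · m)` is at most `1`, with equality only at `m = l`.
  obtain ⟨y, hy, hy1⟩ := exists_mem_of_mem_convexHull (φ := -interLeft (toQ l)) (b := 1)
    (fun x hx => by
      obtain ⟨m, hm, rfl⟩ := hS hx
      have := hle m hm
      simp only [LinearMap.neg_apply, interLeft_apply, inter_toQ]
      have : (-1 : ℚ) ≤ (inter l m : ℤ) := by exact_mod_cast this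
      linarith) h (by simp [hl.1])
  obtain ⟨m, hm, rfl⟩ := hS hy
  simp only [LinearMap.neg_apply, interLeft_apply, inter_toQ] at hy1
  have h1 : inter l m = -1 := by
    have : ((inter l m : ℤ) : ℚ) = -1 := by linarith
    exact_mod_cast this
  rwa [eq_of_lines_of_inter_le hr hl hm h1.le]

/-! ### The facet of a ruling -/

/-- The face of the Gosset polytope on which the intersection number with `f` vanishes. -/
def rulingFacet (f : Pic r) : Set (PicQ r) := {x ∈ gossetPolytope r | inter (toQ f) x = 0}

theorem neg_inter_nonpos_of_mem_lineOrbit (hr₃ : 3 ≤ r) (hr₈ : r ≤ 8) {f : Pic r}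
    (hf : f ∈ rulings r) {x : PicQ r} (hx : x ∈ toQ '' lineOrbit r) :
    (-interLeft (toQ f)) x ≤ 0 := by
  obtain ⟨l, hl, rfl⟩ := hx
  have := line_inter_ruling_nonneg hr₃ hr₈ hl hf
  simp only [LinearMap.neg_apply, interLeft_apply, inter_toQ, Left.neg_nonpos_iff]
  rw [inter_comm]
  exact_mod_cast this

theorem isFace_rulingFacet (hr₃ : 3 ≤ r) (hr₈ : r ≤ 8) {f : Pic r} (hf : f ∈ rulings r) :
    IsFace (gossetPolytope r) (rulingFacet f) := by
  refine ⟨-interLeft (toQ f), 0, fun x hx => ?_, ?_⟩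
  · rw [gossetPolytope_eq] at hx
    exact le_of_mem_convexHull (fun y => neg_inter_nonpos_of_mem_lineOrbit hr₃ hr₈ hf) hx
  · simp [rulingFacet]

theorem rulingFacet_subset (hr₃ : 3 ≤ r) (hr₈ : r ≤ 8) {f : Pic r} (hf : f ∈ rulings r)
    {C : Set (PicQ r)} (hC : Convex ℚ C) (h : ∀ l ∈ lineOrbit r, inter l f = 0 → toQ l ∈ C) :
    rulingFacet f ⊆ C := by
  rintro x ⟨hx, hx0⟩
  rw [gossetPolytope_eq] at hx
  refine convexHull_min ?_ hC
    (mem_convexHull_of_eq (φ := -interLeft (toQ f)) (b := 0)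
      (fun y => neg_inter_nonpos_of_mem_lineOrbit hr₃ hr₈ hf) hx (by simp [hx0]))
  rintro _ ⟨⟨l, hl, rfl⟩, h0⟩
  refine h l hl ?_
  simpa [inter_comm f l] using h0

theorem convex_rulingFacet (f : Pic r) : Convex ℚ (rulingFacet f) :=
  (convex_convexHull ℚ _).inter (convex_hyperplane (interLeft (toQ f)).isLinear 0)

theorem mem_rulingFacet {l f : Pic r} (hl : l ∈ lineOrbit r) (h : inter l f = 0) :
    toQ l ∈ rulingFacet f :=
  ⟨mem_gossetPolytope hl, by rw [inter_toQ, inter_comm, h, Int.cast_zero]⟩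

/-- If `f = w (h - e_i)`, the vertices are `w e_j` and `f - w e_j` for `j ≠ i`. The half-diagonals
`w e_j - f/2` are orthonormal because `f² = f · w e_j = 0`. -/
theorem isCrosspolytope_rulingFacet (hr₃ : 3 ≤ r) (hr₈ : r ≤ 8) {f : Pic r}
    (hf : f ∈ rulings r) : IsCrosspolytope (r - 1) ((1 / 2 : ℚ) • toQ f) (rulingFacet f) := by
  have i : Fin r := ⟨0, by omega⟩
  have e : Fin (r - 1) ≃ {j : Fin r // j ≠ i} :=
    (Fintype.equivFinOfCardEq (by simp [Fintype.card_subtype_compl])).symm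
  obtain ⟨w, hw, hwf⟩ := exists_weyl_hyperplane_sub_eq hr₃ hr₈ i hf
  have hef : ∀ j : {j : Fin r // j ≠ i}, inter (w (exceptional j.1)) f = 0 := fun j => by
    rw [← hwf, inter_weyl hw]
    simp [inter_sub, exceptional_succ, j.2.symm]
  have hadd : ∀ y, (1 / 2 : ℚ) • toQ f + (y - (1 / 2 : ℚ) • toQ f) = y := fun y => by abel
  have hsub : ∀ y, (1 / 2 : ℚ) • toQ f - (toQ y - (1 / 2 : ℚ) • toQ f) = toQ (f - y) := fun y => by
    rw [toQ_sub]; module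
  refine ⟨1, fun k => toQ (w (exceptional (e k).1)) - (1 / 2 : ℚ) • toQ f, one_pos,
    fun k m => ?_, Set.Subset.antisymm ?_ ?_⟩
  · have h1 := hef (e k)
    have h2 := hef (e m)
    rw [inter_comm] at h2
    simp only [sub_inter, inter_sub, smul_inter, inter_smul, inter_toQ, h1, h2, hf.1, inter_weyl hw]
    simp [exceptional_succ, Subtype.val_inj, eq_comm]
  · refine rulingFacet_subset hr₃ hr₈ hf (convex_convexHull ℚ _) fun l hl h => ?_
    apply subset_convexHull
    rw [← hwf] at h
    obtain ⟨j, hj, h⟩ := hyperplane_sub_inter_cases hr₃ hw hl h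
    rw [hwf] at h
    refine h.imp (fun h => ⟨e.symm ⟨j, hj⟩, ?_⟩) fun h => ⟨e.symm ⟨j, hj⟩, ?_⟩
    · simp only [hadd, Equiv.apply_symm_apply, h]
    · simp only [hsub, Equiv.apply_symm_apply, h]
  · refine convexHull_min ?_ (convex_rulingFacet f)
    have ho : ∀ k, w (exceptional (e k).1) ∈ lineOrbit r := fun k =>
      weyl_mem_lineOrbit hw (exceptional_mem_lineOrbit hr₃ _)
    rintro _ (⟨k, rfl⟩ | ⟨k, rfl⟩)
    · simp only [hadd]
      exact mem_rulingFacet (ho k) (hef _)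
    · simp only [hsub]
      exact mem_rulingFacet (sub_mem_lineOrbit hr₃ hr₈ (ho k) hf (hef _))
        (by rw [sub_inter, hf.1, hef, sub_zero])

theorem IsCrosspolytope.center_mem {n : ℕ} (hn : 0 < n) {c : PicQ r} {F : Set (PicQ r)}
    (h : IsCrosspolytope n c F) : c ∈ F := by
  obtain ⟨ρ, v, -, -, rfl⟩ := h
  have h1 : c + v ⟨0, hn⟩ ∈ convexHull ℚ (Set.range (fun i => c + v i) ∪
      Set.range (fun i => c - v i)) := subset_convexHull ℚ _ (Or.inl ⟨_, rfl⟩)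
  have h2 : c - v ⟨0, hn⟩ ∈ convexHull ℚ (Set.range (fun i => c + v i) ∪
      Set.range (fun i => c - v i)) := subset_convexHull ℚ _ (Or.inr ⟨_, rfl⟩)
  have := convex_convexHull ℚ _ h1 h2 (a := 1 / 2) (b := 1 / 2) (by norm_num) (by norm_num)
    (by norm_num)
  convert this using 1
  module

/-- The centre `f/2` of the common facet is orthogonal to `g`, so `(f - g)² = 0`. -/
theorem rulingFacet_injOn (hr₃ : 3 ≤ r) (hr₈ : r ≤ 8) :
    Set.InjOn (rulingFacet (r := r)) (rulings r) := by
  intro f hf g hg h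
  have hc := (isCrosspolytope_rulingFacet hr₃ hr₈ hf).center_mem (by omega)
  rw [h] at hc
  have h0 := hc.2
  rw [inter_smul, inter_toQ] at h0
  have h1 : inter g f = 0 := by simpa using h0
  apply eq_of_inter_sub_nonneg hr₈ (hf.2.trans hg.2.symm)
  simp [sub_inter, inter_sub, hf.1, hg.1, h1, inter_comm f g]

/-! ### Crosspolytope facets come from rulings -/

/-- Central symmetry of the polytope for `r = 8` (the Bertini involution). It suffices to treat
`e_8`, as the Weyl group fixes `K`. The chain of skew lines is `e_7`, `3h - e_1 - ⋯ - e_6 - 2e_8`,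
`-2K - e_8`. -/
theorem neg_two_canonical_sub_mem_lineOrbit {l : Pic 8} (hl : l ∈ lineOrbit 8) :
    -(canonical 8 + canonical 8) - l ∈ lineOrbit 8 := by
  have h7 : exceptional 6 ∈ lineOrbit 8 := exceptional_mem_lineOrbit (by norm_num) 6
  have hb : (![3, -1, -1, -1, -1, -1, -1, 0, -2] : Pic 8) ∈ lineOrbit 8 :=
    mem_lineOrbit_of_inter_eq_zero (by norm_num) h7 (by constructor <;> decide) (by decide)
  have hl' : -(canonical 8 + canonical 8) - lastExceptional 8 ∈ lineOrbit 8 :=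
    mem_lineOrbit_of_inter_eq_zero (by norm_num) hb (by constructor <;> decide) (by decide)
  obtain ⟨w, hw, rfl⟩ := hl
  have := weyl_mem_lineOrbit hw hl'
  rwa [map_sub, map_neg, map_add, weyl_canonical hw] at this

/-- The Hodge index bound for a rational class `c` of degree one with `c² ≥ 1`. -/
theorem eq_neg_canonical_of_one_le (hr : r ≤ 8) {c : PicQ r}
    (hK : inter (toQ (canonical r)) c = -1) (hc : 1 ≤ inter c c) :
    r = 8 ∧ c = -toQ (canonical r) := by
  have hc' := hc
  have hK' := hK
  rw [inter_toQ_canonical] at hK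
  rw [inter_self] at hc
  have h := sq_sum_le_card_mul_sum_sq (s := Finset.univ) (f := fun i : Fin r => c i.succ)
  rw [Finset.card_univ, Fintype.card_fin, show ∑ i : Fin r, c i.succ = 1 - 3 * c 0 by linarith] at h
  have h0 : 0 ≤ ∑ i : Fin r, c i.succ ^ 2 := Finset.sum_nonneg fun i _ => sq_nonneg _
  have hr8 : r = 8 := by
    -- For `r ≤ 7` the bound becomes `(2c₀ - 3)² + 7 ≤ 0`.
    by_contra hne
    have : (r : ℚ) ≤ 7 := by exact_mod_cast (by omega : r ≤ 7)
    nlinarith [sq_nonneg (2 * c 0 - 3)]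
  subst hr8
  refine ⟨rfl, ?_⟩
  rw [← add_eq_zero_iff_eq_neg]
  have hKK : inter (toQ (canonical 8)) (toQ (canonical 8)) = 1 := by
    rw [inter_toQ, canonical_inter_canonical]; norm_num
  apply eq_zero_of_canonical_inter_eq_zero hr
  · rw [inter_add, hK', hKK]; norm_num
  · rw [add_inter, inter_add, inter_add, inter_comm c (toQ _), hK', hKK]
    linarith

theorem exists_ruling_of_mem_crosspolytopeFacets (hr₃ : 3 ≤ r) (hr₈ : r ≤ 8) {F : Set (PicQ r)}
    (hF : F ∈ crosspolytopeFacets r) : ∃ f ∈ rulings r, rulingFacet f = F := by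
  obtain ⟨⟨φ, b, hφ, hFφ⟩, c, hcross⟩ := hF
  have hcF := hcross.center_mem (by omega)
  obtain ⟨ρ, v, hρ, hv, hFv⟩ := hcross
  set V := Set.range (fun i => c + v i) ∪ Set.range (fun i => c - v i)
  have hvv : ∀ i j, inter (v i) (v j) = if i = j then -ρ else 0 := fun i j => by
    have := hv i j
    split_ifs at this ⊢ <;> linarith
  have hφ' := hφ
  rw [gossetPolytope_eq] at hφ'
  have hFV := hFφ.symm.trans hFv
  rw [gossetPolytope_eq] at hFV
  -- On `V`, the form `-(v i · x)` has its strict maximum at `c + v i`, so this vertex is exposed.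
  have hadd : ∀ i, c + v i ∈ toQ '' lineOrbit r := fun i => by
    refine mem_of_exposed (ψ := -interLeft (v i)) hφ' hFV (Or.inl ⟨i, rfl⟩) ?_
    rintro _ (⟨j, rfl⟩ | ⟨j, rfl⟩) hne <;>
      simp only [LinearMap.neg_apply, interLeft_apply, inter_add, inter_sub, hvv, if_true]
    · rw [if_neg (by rintro rfl; exact hne rfl)]; linarith
    · split_ifs <;> linarith
  have hsub : ∀ i, c - v i ∈ toQ '' lineOrbit r := fun i => by
    refine mem_of_exposed (ψ := interLeft (v i)) hφ' hFV (Or.inr ⟨i, rfl⟩) ?_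
    rintro _ (⟨j, rfl⟩ | ⟨j, rfl⟩) hne <;>
      simp only [interLeft_apply, inter_add, inter_sub, hvv, if_true]
    · split_ifs <;> linarith
    · rw [if_neg (by rintro rfl; exact hne rfl)]; linarith
  have hlines := lineOrbit_subset_lines hr₃
  have hcv : ∀ i, inter c (v i) = 0 ∧ inter c c = ρ - 1 := fun i => by
    obtain ⟨l, hl, hl'⟩ := hadd i
    obtain ⟨m, hm, hm'⟩ := hsub i
    have h1 : inter (c + v i) (c + v i) = -1 := by rw [← hl', inter_toQ, (hlines hl).1]; norm_num
    have h2 : inter (c - v i) (c - v i) = -1 := by rw [← hm', inter_toQ, (hlines hm).1]; norm_num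
    simp only [add_inter, inter_add, sub_inter, inter_sub, hvv, if_true, inter_comm (v i) c] at h1 h2
    constructor <;> linarith
  obtain ⟨i, j, hij⟩ : ∃ i j : Fin (r - 1), i ≠ j := ⟨⟨0, by omega⟩, ⟨1, by omega⟩, by simp⟩
  obtain ⟨l, hl, hl'⟩ := hadd i
  obtain ⟨m, hm, hm'⟩ := hsub i
  have hlm : toQ (l + m) = (2 : ℚ) • c := by rw [toQ_add, hl', hm']; module
  have hKc : inter (toQ (canonical r)) c = -1 := by
    have : inter (toQ (canonical r)) ((2 : ℚ) • c) = -2 := by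
      rw [← hlm, inter_toQ, inter_add, (hlines hl).2, (hlines hm).2]; norm_num
    rw [inter_smul] at this
    linarith
  -- `c² = ρ - 1 > -1` equals the intersection number of the lines `c + v i` and `c + v j`, so it is
  -- a non-negative integer.
  have hcc : inter c c = 0 := by
    obtain ⟨n, hn, hn'⟩ := hadd j
    have h1 : inter (toQ l) (toQ n) = ρ - 1 := by
      rw [hl', hn']
      simp [add_inter, inter_add, hvv, hij, (hcv j).1, inter_comm (v i) c, (hcv i).1, (hcv i).2]
    rw [inter_toQ] at h1
    rw [(hcv i).2, ← h1]
    by_contra hne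
    have hge : 1 ≤ inter c c := by
      rw [(hcv i).2, ← h1]
      have h2 : (-1 : ℚ) < (inter l n : ℤ) := by linarith
      have h3 : -1 < inter l n := by exact_mod_cast h2
      have h4 : inter l n ≠ 0 := by exact_mod_cast hne
      exact_mod_cast (by omega : 1 ≤ inter l n)
    obtain ⟨rfl, hcK⟩ := eq_neg_canonical_of_one_le hr₈ hKc hge
    have hρ2 : ρ = 2 := by
      have h2 := (hcv i).2
      rw [hcK, neg_inter, inter_neg, inter_toQ, canonical_inter_canonical] at h2
      norm_num at h2
      linarith
    -- The centre `c` is the midpoint of `x` and `-2K - x`. Since `φ ≤ b` at both and `φ c = b`,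
    -- equality holds at `x`.
    have hall : ∀ x ∈ lineOrbit 8, toQ x ∈ V := fun x hx => by
      refine mem_of_mem_convexHull_lines le_rfl (hlines hx) ?_ ?_
      · rintro _ (⟨k, rfl⟩ | ⟨k, rfl⟩)
        · exact Set.image_mono hlines (hadd k)
        · exact Set.image_mono hlines (hsub k)
      · rw [← hFv, hFφ]
        have hx' := neg_two_canonical_sub_mem_lineOrbit hx
        have h2 := hφ _ (mem_gossetPolytope hx)
        have h3 := hφ _ (mem_gossetPolytope hx')
        rw [toQ_sub, toQ_neg, toQ_add, neg_add, ← hcK, map_sub, map_add] at h3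
        rw [hFφ] at hcF
        have h4 := hcF.2
        exact ⟨mem_gossetPolytope hx, by linarith⟩
    have h01 : inter (toQ (exceptional (0 : Fin 8))) (toQ (exceptional (1 : Fin 8))) = 0 := by
      rw [inter_toQ, inter_exceptional, exceptional_succ]; norm_num
    have hc1 : inter c c = 1 := by rw [(hcv i).2, hρ2]; norm_num
    have hvc : ∀ k, inter (v k) c = 0 := fun k => by rw [inter_comm, (hcv k).1]
    -- Two points of `V` meet in `1`, `-1` or `3`, never in `0`.
    rcases hall _ (exceptional_mem_lineOrbit hr₃ 0) with ⟨s, hs⟩ | ⟨s, hs⟩ <;>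
    rcases hall _ (exceptional_mem_lineOrbit hr₃ 1) with ⟨t, ht⟩ | ⟨t, ht⟩ <;>
    · rw [← hs, ← ht] at h01
      simp only [add_inter, inter_add, sub_inter, inter_sub, hvv, (hcv _).1, hvc, hc1, hρ2] at h01
      split_ifs at h01 <;> norm_num at h01
  have hf : l + m ∈ rulings r := by
    constructor
    · have : inter (toQ (l + m)) (toQ (l + m)) = 0 := by
        rw [hlm, smul_inter, inter_smul, hcc]; norm_num
      rw [inter_toQ] at this
      exact_mod_cast this
    · rw [inter_add, (hlines hl).2, (hlines hm).2]; norm_num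
  refine ⟨l + m, hf, Set.Subset.antisymm ?_ ?_⟩
  -- The same midpoint argument, with `f - x` as the vertex opposite to `x`.
  · refine rulingFacet_subset hr₃ hr₈ hf (hFv ▸ convex_convexHull ℚ _) fun x hx h => ?_
    have hx' := sub_mem_lineOrbit hr₃ hr₈ hx hf h
    have h2 := hφ _ (mem_gossetPolytope hx)
    have h3 := hφ _ (mem_gossetPolytope hx')
    rw [toQ_sub, hlm, map_sub, map_smul, smul_eq_mul] at h3
    rw [hFφ] at hcF ⊢
    have h4 := hcF.2
    exact ⟨mem_gossetPolytope hx, by linarith⟩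
  · have hFP : F ⊆ gossetPolytope r := by rw [hFφ]; exact fun x hx => hx.1
    have hVF : V ⊆ F := by rw [hFv]; exact subset_convexHull ℚ V
    rw [hFv]
    refine convexHull_min ?_ (convex_rulingFacet _)
    intro x hx
    refine ⟨hFP (hVF hx), ?_⟩
    rw [hlm, smul_inter]
    rcases hx with ⟨k, rfl⟩ | ⟨k, rfl⟩
    · simp only [inter_add, hcc, (hcv k).1]; norm_num
    · simp only [inter_sub, hcc, (hcv k).1]; norm_num

/-- Rulings correspond to crosspolytope facets of the Gosset polytope. -/
noncomputable def rulingsEquivFacets (hr₃ : 3 ≤ r) (hr₈ : r ≤ 8) :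
    rulings r ≃ crosspolytopeFacets r :=
  Equiv.ofBijective
    (fun f => ⟨rulingFacet f.1, isFace_rulingFacet hr₃ hr₈ f.2, _,
      isCrosspolytope_rulingFacet hr₃ hr₈ f.2⟩)
    ⟨fun f g h => Subtype.ext (rulingFacet_injOn hr₃ hr₈ f.2 g.2 (congrArg Subtype.val h)),
      fun F => by
        obtain ⟨f, hf, h⟩ := exists_ruling_of_mem_crosspolytopeFacets hr₃ hr₈ F.2
        exact ⟨⟨f, hf⟩, Subtype.ext h⟩⟩

end DelPezzo

theorem mainTheorem3 (r : ℕ) (hr₃ : 3 ≤ r) (hr₈ : r ≤ 8) :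
    (∀ f ∈ DelPezzo.rulings r, ∃ l₁ ∈ DelPezzo.lines r, ∃ l₂ ∈ DelPezzo.lines r,
      DelPezzo.inter l₁ l₂ = 1 ∧ f = l₁ + l₂) ∧
    (∃ Φ : DelPezzo.rulings r ≃ DelPezzo.crosspolytopeFacets r,
      ∀ f : DelPezzo.rulings r,
        DelPezzo.IsCrosspolytope (r - 1) ((1 / 2 : ℚ) • DelPezzo.toQ f.1) (Φ f).1) ∧
    (DelPezzo.rulings r).Nonempty ∧
    (∀ w ∈ DelPezzo.weylGroup r, ∀ f ∈ DelPezzo.rulings r, w f ∈ DelPezzo.rulings r) ∧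
    (∀ f ∈ DelPezzo.rulings r, ∀ g ∈ DelPezzo.rulings r,
      ∃ w ∈ DelPezzo.weylGroup r, w f = g) :=
  ⟨fun _ hf => DelPezzo.exists_lines_add_eq hr₃ hr₈ hf,
    ⟨DelPezzo.rulingsEquivFacets hr₃ hr₈,
      fun f => DelPezzo.isCrosspolytope_rulingFacet hr₃ hr₈ f.2⟩,
    ⟨_, DelPezzo.hyperplane_sub_mem_rulings ⟨0, by omega⟩⟩,
    fun _ hw _ hf => DelPezzo.weyl_mem_rulings hw hf,
    fun _ hf _ hg => DelPezzo.exists_weyl_eq_of_mem_rulings hr₃ hr₈ hf hg⟩
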